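/- **Modal side.** Modal formulas are given by $\varphi ::= \bot \mid p_j \mid \neg\varphi \mid \varphi\wedge\varphi \mid \Box\varphi$, $j\in\omega$. A *neighbourhood model* is a triple $M=\langle S,\nu,V\rangle$ with $S$ a (possibly empty) set, $\nu\colon S\to\mathcal P(\mathcal P(S))$ and $V\colon\{p_j\mid j\in\omega\}\to\mathcal P(S)$. A *bounded morphism* $f\colon\langle S_1,\nu_1,V_1\rangle\to\langle S_2,\nu_2,V_2\rangle$ is a function $f\colon S_1\to S_2$ such that for all $s\in S_1$, $X\subseteq S_2$, $j\in\omega$: $f^{-1}[X]\in\nu_1(s)$ iff $X\in\nu_2(f(s))$, and $s\in V_1(p_j)$ iff $f(s)\in V_2(p_j)$. Let $M_1,M_2$ be neighbourhood models with state sets $S_1,S_2$, and let $s_1\in S_1$, $s_2\in S_2$. - $s_1,s_2$ are *behaviourally equivalent* if there are a neighbourhood model $N$ and bounded morphisms $f_i\colon M_i\to N$ ($i=1,2$) with $f_1(s_1)=f_2(s_2)$. - A relation $R\subseteq S_1\times S_2$ is a *precocongruence* if the pushout $P=(S_1+S_2)/{\approx}$, where $\approx$ is the equivalence relation generated by identifying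 $x_1$ with $x_2$ for all $(x_1,x_2)\in R$, is the state set of some neighbourhood model for which both canonical maps $S_i\to P$ are bounded morphisms from $M_i$. - A relation $R\subseteq S_1\times S_2$ is a *$2^2$-bisimulation* (between models, so atoms are included) if $R$ is the state set of some neighbourhood model for which both projections $R\to S_i$ are bounded morphisms to $M_i$. States are *$2^2$-bisimilar* if some $2^2$-bisimulation relates them. **First-order side.** Consider the two-sorted first-order language with equality, with a sort $\mathsf s$ of states (variables $x,y,\dots$) and a sort $\mathsf n$ of neighbourhoods (variables $u,v,\dots$), with unary predicates $\mathsf P_i$ on $\mathsf s$ ($i\in\omega$), a relation $x\mathsf N u$ between $\mathsf s$ and $\mathsf n$, and a relation $u\mathsf E x$ between $\mathsf n$ and $\mathsf s$. Formulas are built from the atomic formulas $x=y$, $u=v$, $\mathsf P_ix$, $x\mathsf Nu$, $u\mathsf Ex$ by $\neg$, $\wedge$, $\exists x$, $\exists u$, and are interpreted as usual in structures $\langle D^{\mathsf s},D^{\mathsf n},\{P_i\}_{i\in\omega},N,E\rangle$ (carriers may be empty). The *first-order translation* $M^\circ$ of $M=\langle S,\nu,V\rangle$ has $D^{\mathsf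 s}=S$, $D^{\mathsf n}=\bigcup_{s\in S}\nu(s)$, $P_i=V(p_i)$, $N=\{(s,U)\mid U\in\nu(s)\}$ and $E=\{(U,s)\mid s\in U\}$. Let $\mathbf N$ be the class of structures isomorphic to $M^\circ$ for some neighbourhood model $M$. To $\mathfrak M\in\mathbf N$ corresponds the neighbourhood model $\mathfrak M_\circ=\langle D^{\mathsf s},\nu,V\rangle$ with $V(p_i)=P_i$ and $\nu(s)=\{\{t\mid aEt\}\mid a\in D^{\mathsf n},\ sNa\}$. The *standard translation* is given by $st_x(\bot)=\neg(x=x)$, $st_x(p_i)=\mathsf P_ix$, $st_x(\neg\varphi)=\neg st_x(\varphi)$, $st_x(\varphi\wedge\psi)=st_x(\varphi)\wedge st_x(\psi)$, $st_x(\Box\varphi)=\exists u\,(x\mathsf Nu\wedge\forall y\,(u\mathsf Ey\leftrightarrow st_y(\varphi)))$. **Theorem.** Let $\alpha(x)$ be a formula of this two-sorted language with no free variable other than the state variable $x$. The following are equivalent. 1. *$\alpha(x)$ is equivalent over $\mathbf N$ to the translation of a modal formula*: there is a modal formula $\varphi$ such that for all $\mathfrak M\in\mathbf N$ and all $s\in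 D^{\mathsf s}$ in $\mathfrak M$, $\mathfrak M\models\alpha[s]$ iff $\mathfrak M\models st_x(\varphi)[s]$. 2. *$\alpha(x)$ is invariant over $\mathbf N$ under behavioural equivalence*: for all $\mathfrak M_1,\mathfrak M_2\in\mathbf N$ and all states $s_1$ of $\mathfrak M_1$, $s_2$ of $\mathfrak M_2$, if $s_1,s_2$ are behaviourally equivalent as states of $(\mathfrak M_1)_\circ,(\mathfrak M_2)_\circ$, then $\mathfrak M_1\models\alpha[s_1]$ iff $\mathfrak M_2\models\alpha[s_2]$. 3. *$\alpha(x)$ is invariant over $\mathbf N$ under precocongruences*: the same as in 2, for $s_1,s_2$ related by some precocongruence between $(\mathfrak M_1)_\circ$ and $(\mathfrak M_2)_\circ$. 4. *$\alpha(x)$ is invariant over $\mathbf N$ under $2^2$-bisimilarity*: the same as in 2, for $s_1,s_2$ that are $2^2$-bisimilar as states of $(\mathfrak M_1)_\circ,(\mathfrak M_2)_\circ$. -/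

import Mathlib

universe u v

/-- Formulas of the basic modal language over the countable set of atoms `p_j`, `j : ℕ`. -/
inductive ModalFormula : Type
  | bot : ModalFormula
  | atom (j : ℕ) : ModalFormula
  | neg (φ : ModalFormula) : ModalFormula
  | and (φ ψ : ModalFormula) : ModalFormula
  | box (φ : ModalFormula) : ModalFormula

/-- A neighbourhood model with set of states `S`: a neighbourhood function and a valuation.
Equivalently, a coalgebra with carrier `S` for the functor `2^2(-) × 𝒫(At)`. -/
structure NbhdModel (S : Type u) where
  /-- The collection of neighbourhoods of a state. -/
  nu : S → Set (Set S)
  /-- The valuation of the atoms. -/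
  V : ℕ → Set S

/-- Bounded morphisms between neighbourhood models, that is, coalgebra morphisms for the functor
`2^2(-) × 𝒫(At)`. -/
structure IsBoundedMorphism {S₁ : Type u} {S₂ : Type v} (M₁ : NbhdModel S₁) (M₂ : NbhdModel S₂)
    (f : S₁ → S₂) : Prop where
  nu_iff : ∀ (s : S₁) (X : Set S₂), f ⁻¹' X ∈ M₁.nu s ↔ X ∈ M₂.nu (f s)
  V_iff : ∀ (j : ℕ) (s : S₁), s ∈ M₁.V j ↔ f s ∈ M₂.V j

section Equivalences

variable {S₁ S₂ : Type u}

/-- `R` is a bisimulation between `M₁` and `M₂`: the set of pairs `R ⊆ S₁ × S₂` carries a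
coalgebra structure that makes both projections coalgebra morphisms. -/
def IsBisimulation (M₁ : NbhdModel S₁) (M₂ : NbhdModel S₂) (R : Set (S₁ × S₂)) : Prop :=
  ∃ ρ : NbhdModel R,
    IsBoundedMorphism ρ M₁ (fun z => z.1.1) ∧ IsBoundedMorphism ρ M₂ (fun z => z.1.2)

/-- Two states are bisimilar if they are linked by a bisimulation. -/
def Bisimilar (M₁ : NbhdModel S₁) (M₂ : NbhdModel S₂) (s₁ : S₁) (s₂ : S₂) : Prop :=
  ∃ R : Set (S₁ × S₂), IsBisimulation M₁ M₂ R ∧ (s₁, s₂) ∈ R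

/-- Two states are behaviourally equivalent if they are identified by a pair of coalgebra
morphisms into some common coalgebra. -/
def BehEquivalent (M₁ : NbhdModel S₁) (M₂ : NbhdModel S₂) (s₁ : S₁) (s₂ : S₂) : Prop :=
  ∃ (Y : Type u) (N : NbhdModel Y) (f₁ : S₁ → Y) (f₂ : S₂ → Y),
    IsBoundedMorphism M₁ N f₁ ∧ IsBoundedMorphism M₂ N f₂ ∧ f₁ s₁ = f₂ s₂

/-- The relation `R ⊆ S₁ × S₂`, viewed as a relation on the disjoint union `S₁ + S₂`. -/
def sumRel (R : Set (S₁ × S₂)) (a b : S₁ ⊕ S₂) : Prop :=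
  ∃ z ∈ R, a = Sum.inl z.1 ∧ b = Sum.inr z.2

/-- The pushout of (the projections of) `R`: the quotient of `S₁ + S₂` by the equivalence relation
generated by `R`. -/
def RelPushout (R : Set (S₁ × S₂)) : Type u := Quot (sumRel R)

/-- The pushout map from the first set. -/
def RelPushout.inl (R : Set (S₁ × S₂)) (s : S₁) : RelPushout R := Quot.mk (sumRel R) (Sum.inl s)

/-- The pushout map from the second set. -/
def RelPushout.inr (R : Set (S₁ × S₂)) (s : S₂) : RelPushout R := Quot.mk (sumRel R) (Sum.inr s)

/-- `R` is a precocongruence between `M₁` and `M₂`: the pushout of `R` carries a coalgebra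
structure that makes both pushout maps coalgebra morphisms. -/
def IsPrecocongruence (M₁ : NbhdModel S₁) (M₂ : NbhdModel S₂) (R : Set (S₁ × S₂)) : Prop :=
  ∃ lam : NbhdModel (RelPushout R),
    IsBoundedMorphism M₁ lam (RelPushout.inl R) ∧ IsBoundedMorphism M₂ lam (RelPushout.inr R)

/-- Two states are related by some precocongruence. -/
def PrecocongRelated (M₁ : NbhdModel S₁) (M₂ : NbhdModel S₂) (s₁ : S₁) (s₂ : S₂) : Prop :=
  ∃ R : Set (S₁ × S₂), IsPrecocongruence M₁ M₂ R ∧ (s₁, s₂) ∈ R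

end Equivalences

/-- Formulas of the two-sorted first-order language whose free state variables are among
`x_0, …, x_{n-1}` and whose free neighbourhood variables are among `u_0, …, u_{m-1}`.  A quantifier
binds the variable with index `0` of its body, and the index of every other variable of that sort
is raised by one under the quantifier. -/
inductive FOFormula : ℕ → ℕ → Type
  | eqS {n m : ℕ} (x y : Fin n) : FOFormula n m
  | eqN {n m : ℕ} (u v : Fin m) : FOFormula n m
  | relP {n m : ℕ} (i : ℕ) (x : Fin n) : FOFormula n m
  | relN {n m : ℕ} (x : Fin n) (u : Fin m) : FOFormula n m
  | relE {n m : ℕ} (u : Fin m) (x : Fin n) : FOFormula n m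
  | neg {n m : ℕ} (φ : FOFormula n m) : FOFormula n m
  | and {n m : ℕ} (φ ψ : FOFormula n m) : FOFormula n m
  | exS {n m : ℕ} (φ : FOFormula (n + 1) m) : FOFormula n m
  | exN {n m : ℕ} (φ : FOFormula n (m + 1)) : FOFormula n m

namespace FOFormula

variable {n m : ℕ}

/-- Implication, as an abbreviation. -/
def imp (φ ψ : FOFormula n m) : FOFormula n m := (φ.and ψ.neg).neg

/-- Biimplication, as an abbreviation. -/
def iff (φ ψ : FOFormula n m) : FOFormula n m := (φ.imp ψ).and (ψ.imp φ)

/-- Universal quantification over states, as an abbreviation. -/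
def allS (φ : FOFormula (n + 1) m) : FOFormula n m := φ.neg.exS.neg

end FOFormula

/-- Two-sorted first-order structures.  Both carriers may be empty. -/
structure FOStructure where
  /-- The carrier of the sort of states. -/
  Ds : Type u
  /-- The carrier of the sort of neighbourhoods. -/
  Dn : Type u
  /-- The interpretation of the unary predicates. -/
  P : ℕ → Ds → Prop
  /-- `N s a` interprets "`a` is a neighbourhood of `s`". -/
  N : Ds → Dn → Prop
  /-- `E a s` interprets "`s` is an element of `a`". -/
  E : Dn → Ds → Prop

/-- Truth of a formula in a structure, under assignments to the variables of either sort that may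
occur free in it. -/
def FOStructure.Sat (A : FOStructure.{u}) :
    {n m : ℕ} → FOFormula n m → (Fin n → A.Ds) → (Fin m → A.Dn) → Prop
  | _, _, .eqS x y, a, _ => a x = a y
  | _, _, .eqN u v, _, b => b u = b v
  | _, _, .relP i x, a, _ => A.P i (a x)
  | _, _, .relN x u, a, b => A.N (a x) (b u)
  | _, _, .relE u x, a, b => A.E (b u) (a x)
  | _, _, .neg φ, a, b => ¬ A.Sat φ a b
  | _, _, .and φ ψ, a, b => A.Sat φ a b ∧ A.Sat ψ a b
  | n, _, .exS φ, a, b => ∃ d : A.Ds, A.Sat φ (Fin.cons d a : Fin (n + 1) → A.Ds) b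
  | _, m, .exN φ, a, b => ∃ d : A.Dn, A.Sat φ a (Fin.cons d b : Fin (m + 1) → A.Dn)

/-- `A ⊨ α[s]`, for a formula `α(x)` whose only free variable is one state variable. -/
def FOStructure.Models (A : FOStructure.{u}) (α : FOFormula 1 0) (s : A.Ds) : Prop :=
  A.Sat α (fun _ => s) Fin.elim0

/-- Isomorphisms of two-sorted first-order structures. -/
structure FOStructure.Iso (A B : FOStructure.{u}) where
  /-- The bijection between the states. -/
  onS : A.Ds ≃ B.Ds
  /-- The bijection between the neighbourhoods. -/
  onN : A.Dn ≃ B.Dn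
  P_iff : ∀ (i : ℕ) (s : A.Ds), A.P i s ↔ B.P i (onS s)
  N_iff : ∀ (s : A.Ds) (a : A.Dn), A.N s a ↔ B.N (onS s) (onN a)
  E_iff : ∀ (a : A.Dn) (s : A.Ds), A.E a s ↔ B.E (onN a) (onS s)

/-- The first-order translation of a neighbourhood model. -/
def NbhdModel.toFO {S : Type u} (M : NbhdModel S) : FOStructure.{u} where
  Ds := S
  Dn := {U : Set S // ∃ s, U ∈ M.nu s}
  P i s := s ∈ M.V i
  N s U := U.1 ∈ M.nu s
  E U s := s ∈ U.1

/-- The class of structures that are isomorphic to the translation of a neighbourhood model. -/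
def classN : Set FOStructure.{u} :=
  {A | ∃ (S : Type u) (M : NbhdModel S), Nonempty (A.Iso M.toFO)}

/-- The neighbourhood model that corresponds to a structure: its states are the elements of the
sort of states, and its neighbourhoods are the extensions of the elements of the other sort. -/
def FOStructure.toNbhd (A : FOStructure.{u}) : NbhdModel A.Ds where
  nu s := {X | ∃ a : A.Dn, A.N s a ∧ X = {t | A.E a t}}
  V i := {s | A.P i s}

/-- The standard translation `st_x`; in the clause for `□φ` it is
`∃ u (x N u ∧ ∀ y (u E y ↔ st_y(φ)))`. -/
def ModalFormula.st : ModalFormula → {n m : ℕ} → Fin n → FOFormula n m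
  | .bot, _, _, x => (FOFormula.eqS x x).neg
  | .atom i, _, _, x => .relP i x
  | .neg φ, _, _, x => (φ.st x).neg
  | .and φ ψ, _, _, x => (φ.st x).and (ψ.st x)
  | .box φ, _, _, x =>
      .exN ((FOFormula.relN x 0).and (FOFormula.allS ((FOFormula.relE 0 0).iff (φ.st 0))))

/-- Over the class of translations of neighbourhood models, `α(x)` is equivalent to the standard
translation of a modal formula. -/
def EquivToModal (α : FOFormula 1 0) : Prop :=
  ∃ φ : ModalFormula, ∀ A ∈ classN.{u}, ∀ s : A.Ds, A.Models α s ↔ A.Models (φ.st 0) s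

/-- Over the class of translations of neighbourhood models, `α(x)` is invariant under the relation
`rel` between states of neighbourhood models; a structure in the class is regarded as its
corresponding neighbourhood model. -/
def InvariantUnder
    (rel : ∀ {S₁ S₂ : Type u}, NbhdModel S₁ → NbhdModel S₂ → S₁ → S₂ → Prop)
    (α : FOFormula 1 0) : Prop :=
  ∀ A₁ ∈ classN.{u}, ∀ A₂ ∈ classN.{u}, ∀ (s₁ : A₁.Ds) (s₂ : A₂.Ds),
    rel A₁.toNbhd A₂.toNbhd s₁ s₂ → (A₁.Models α s₁ ↔ A₂.Models α s₂)

/-! Bounded morphisms preserve modal truth, which gives 1 ⇒ 2. The pushout of a bisimulation is a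
common target of bounded morphisms, which gives 2 ⇒ 3 ⇒ 4. Since the graph of a bounded morphism is
a bisimulation, two states identified in a common target are each bisimilar to their shared image,
which gives 4 ⇒ 2.

The substance is 2 ⇒ 1. If no modal formula defines α, then for every k some two pointed structures
agree on the first k modal formulas but not on α (`exists_definition`). All these pairs are placed
in one disjoint union, and a nonprincipal ultrapower over ℕ turns them into two modally equivalent
states that differ on α, by Łoś. The ultrapower is countably saturated and there are only countably
many modal formulas, so each of its neighbourhoods that is closed under modal equivalence is modally
definable (`exists_truth_eq_of_closed`). Hence the quotient by modal equivalence is a neighbourhood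
model, and the two states are behaviourally equivalent, contradicting invariance. -/

open Filter

/-! ### Modal formulas and finite definability -/

namespace ModalFormula

/-- An injective numbering of the modal formulas. -/
def code : ModalFormula → ℕ
  | bot => Nat.pair 0 0
  | atom j => Nat.pair 1 j
  | neg φ => Nat.pair 2 φ.code
  | and φ ψ => Nat.pair 3 (Nat.pair φ.code ψ.code)
  | box φ => Nat.pair 4 φ.code

theorem code_injective : Function.Injective code := by
  intro φ
  induction φ with
  | bot => intro ψ h; cases ψ <;> simp [code, Nat.pair_eq_pair] at h ⊢
  | atom j => intro ψ h; cases ψ <;> simp_all [code, Nat.pair_eq_pair]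
  | neg φ ih =>
    intro ψ h
    cases ψ <;> simp only [code, Nat.pair_eq_pair] at h <;> try omega
    rw [ih h.2]
  | and φ χ ih ih' =>
    intro ψ h
    cases ψ <;> simp only [code, Nat.pair_eq_pair] at h <;> try omega
    rw [ih h.2.1, ih' h.2.2]
  | box φ ih =>
    intro ψ h
    cases ψ <;> simp only [code, Nat.pair_eq_pair] at h <;> try omega
    rw [ih h.2]

instance : Countable ModalFormula := code_injective.countable

instance : Nonempty ModalFormula := ⟨bot⟩

/-- The set of states of a neighbourhood model at which a modal formula is true. -/
def truth {S : Type u} (M : NbhdModel S) : ModalFormula → Set S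
  | bot => ∅
  | atom j => M.V j
  | neg φ => (φ.truth M)ᶜ
  | and φ ψ => φ.truth M ∩ ψ.truth M
  | box φ => {s | φ.truth M ∈ M.nu s}

/-- A set of points that is invariant under agreement on finitely many modal formulas is defined by
a modal formula. -/
theorem exists_definition {W : Type*} (v : W → ModalFormula → Prop)
    (hbot : ∀ w, ¬ v w bot) (hneg : ∀ w φ, v w (neg φ) ↔ ¬ v w φ)
    (hand : ∀ w φ ψ, v w (and φ ψ) ↔ v w φ ∧ v w ψ) (e : ℕ → ModalFormula) (k : ℕ) (X : Set W)
    (hX : ∀ w w', (∀ j < k, v w (e j) ↔ v w' (e j)) → w ∈ X → w' ∈ X) :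
    ∃ φ, ∀ w, w ∈ X ↔ v w φ := by
  induction k generalizing X with
  | zero =>
    by_cases h : ∃ w, w ∈ X
    · obtain ⟨w, hw⟩ := h
      exact ⟨neg bot, fun w' => ⟨fun _ => (hneg _ _).2 (hbot _),
        fun _ => hX w w' (by simp) hw⟩⟩
    · exact ⟨bot, fun w => ⟨fun hw => (h ⟨w, hw⟩).elim, fun hw => (hbot w hw).elim⟩⟩
  | succ k ih =>
    -- Splitting `X` by the truth value of `e k` and closing each half under agreement on the first
    -- `k` formulas brings it within reach of the induction hypothesis.
    have key (p : Prop) : ∃ φ, ∀ w,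
        (∃ w' ∈ X, (v w' (e k) ↔ p) ∧ ∀ j < k, v w' (e j) ↔ v w (e j)) ↔ v w φ := by
      refine ih {w | ∃ w' ∈ X, (v w' (e k) ↔ p) ∧ ∀ j < k, v w' (e j) ↔ v w (e j)} ?_
      rintro w w₂ h ⟨w', hw', hp, hj⟩
      exact ⟨w', hw', hp, fun j hjk => (hj j hjk).trans (h j hjk)⟩
    obtain ⟨φ, hφ⟩ := key True
    obtain ⟨ψ, hψ⟩ := key False
    -- This is (φ ∧ e k) ∨ (ψ ∧ ¬ e k), written without disjunction.
    refine ⟨neg (and (neg (and φ (e k))) (neg (and ψ (neg (e k))))), fun w => ?_⟩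
    simp only [hneg, hand, ← hφ, ← hψ]
    constructor
    · intro hw
      by_cases h : v w (e k)
      · exact fun h' => h'.1 ⟨⟨w, hw, by simp [h], by simp⟩, h⟩
      · exact fun h' => h'.2 ⟨⟨w, hw, by simp [h], by simp⟩, h⟩
    · intro h
      by_contra hw
      refine h ⟨?_, ?_⟩
      · rintro ⟨⟨w', hw', hp, hj⟩, hk⟩
        refine hw (hX w' w (fun j hj' => ?_) hw')
        rcases Nat.lt_succ_iff_lt_or_eq.1 hj' with h' | rfl
        · exact hj j h'
        · simp_all
      · rintro ⟨⟨w', hw', hp, hj⟩, hk⟩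
        refine hw (hX w' w (fun j hj' => ?_) hw')
        rcases Nat.lt_succ_iff_lt_or_eq.1 hj' with h' | rfl
        · exact hj j h'
        · simp_all

end ModalFormula

/-! ### Modal truth and the first-order translation -/

open ModalFormula

/-- Bounded morphisms preserve and reflect the truth of modal formulas. -/
theorem IsBoundedMorphism.preimage_truth {S₁ : Type u} {S₂ : Type v} {M₁ : NbhdModel S₁}
    {M₂ : NbhdModel S₂} {f : S₁ → S₂} (hf : IsBoundedMorphism M₁ M₂ f) (φ : ModalFormula) :
    f ⁻¹' φ.truth M₂ = φ.truth M₁ := by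
  induction φ with
  | bot => rfl
  | atom j => ext s; exact (hf.V_iff j s).symm
  | neg φ ih => simp only [truth, Set.preimage_compl, ih]
  | and φ ψ ih ih' => simp only [truth, Set.preimage_inter, ih, ih']
  | box φ ih =>
    ext s
    simp only [truth, Set.mem_preimage, Set.mem_ofPred_eq]
    rw [← hf.nu_iff, ih]

theorem IsBoundedMorphism.id {S : Type u} (M : NbhdModel S) :
    IsBoundedMorphism M M (fun s => s) :=
  ⟨fun _ _ => Iff.rfl, fun _ _ => Iff.rfl⟩

/-- The standard translation expresses the truth of modal formulas. -/
theorem FOStructure.sat_st (A : FOStructure.{u}) (φ : ModalFormula) {n m : ℕ} (x : Fin n)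
    (a : Fin n → A.Ds) (b : Fin m → A.Dn) :
    A.Sat (φ.st x) a b ↔ a x ∈ φ.truth A.toNbhd := by
  induction φ generalizing n m with
  | bot => simp [ModalFormula.st, Sat, truth]
  | atom j => rfl
  | neg φ ih => simp [ModalFormula.st, Sat, truth, ih]
  | and φ ψ ih ih' => simp [ModalFormula.st, Sat, truth, ih, ih']
  | box φ ih =>
    simp only [ModalFormula.st, FOFormula.allS, FOFormula.iff, FOFormula.imp, Sat, ih, truth,
      toNbhd, Set.mem_ofPred_eq, Set.ext_iff, Fin.cons_zero]
    refine exists_congr fun d => and_congr_right fun _ => ?_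
    rw [not_exists]
    refine forall_congr' fun t => ?_
    tauto

theorem FOStructure.models_st (A : FOStructure.{u}) (φ : ModalFormula) (s : A.Ds) :
    A.Models (φ.st 0) s ↔ s ∈ φ.truth A.toNbhd :=
  A.sat_st φ 0 _ _

/-- Together with `toFO_mem_classN`, this lets invariance hypotheses be applied to arbitrary
neighbourhood models. -/
theorem NbhdModel.toNbhd_toFO {S : Type u} (M : NbhdModel S) : M.toFO.toNbhd = M := by
  obtain ⟨nu, V⟩ := M
  simp only [NbhdModel.toFO, FOStructure.toNbhd, NbhdModel.mk.injEq]
  refine ⟨?_, rfl⟩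
  funext s
  ext X
  constructor
  · rintro ⟨U, hU, rfl⟩
    exact hU
  · intro hX
    exact ⟨⟨X, s, hX⟩, hX, rfl⟩

theorem NbhdModel.toFO_mem_classN {S : Type u} (M : NbhdModel S) : M.toFO ∈ classN :=
  ⟨S, M, ⟨⟨Equiv.refl _, Equiv.refl _, fun _ _ => Iff.rfl, fun _ _ => Iff.rfl,
    fun _ _ => Iff.rfl⟩⟩⟩

/-- Structures in which neighbourhoods are determined by their extension, and in which every
neighbourhood belongs to some state, are translations of neighbourhood models. -/
theorem mem_classN_of_extensional {A : FOStructure.{u}}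
    (hext : ∀ a b, (∀ t, A.E a t ↔ A.E b t) → a = b) (hN : ∀ a, ∃ s, A.N s a) : A ∈ classN := by
  refine ⟨A.Ds, A.toNbhd, ⟨⟨Equiv.refl _, Equiv.ofBijective
    (fun a => ⟨{t | A.E a t}, (hN a).imp fun s hs => ⟨a, hs, rfl⟩⟩) ⟨?_, ?_⟩, ?_, ?_, ?_⟩⟩⟩
  · intro a b hab
    exact hext a b fun t => Set.ext_iff.1 (Subtype.ext_iff.1 hab) t
  · rintro ⟨X, s, a, ha, rfl⟩
    exact ⟨a, rfl⟩
  · exact fun _ _ => Iff.rfl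
  · intro s a
    constructor
    · exact fun h => ⟨a, h, rfl⟩
    · rintro ⟨b, hb, hab⟩
      rwa [hext a b fun t => Set.ext_iff.1 hab t]
  · exact fun _ _ => Iff.rfl

/-! ### Comparing the three relations between states -/

section Relations

variable {S₁ S₂ : Type u} {M₁ : NbhdModel S₁} {M₂ : NbhdModel S₂}

theorem PrecocongRelated.behEquivalent {s₁ : S₁} {s₂ : S₂} (h : PrecocongRelated M₁ M₂ s₁ s₂) :
    BehEquivalent M₁ M₂ s₁ s₂ := by
  obtain ⟨R, ⟨lam, h₁, h₂⟩, hR⟩ := h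
  exact ⟨_, lam, _, _, h₁, h₂, Quot.sound ⟨_, hR, rfl, rfl⟩⟩

/-- Both routes from `R` to the pushout agree, so membership conditions on either side of a glued
pair reduce to the same condition in `ρ`. The structure defined by taking preimages is therefore
well defined on the quotient. -/
theorem IsBisimulation.isPrecocongruence {R : Set (S₁ × S₂)} (h : IsBisimulation M₁ M₂ R) :
    IsPrecocongruence M₁ M₂ R := by
  obtain ⟨ρ, h₁, h₂⟩ := h
  have hcomp (X : Set (RelPushout R)) :
      (fun z : R => z.1.1) ⁻¹' (RelPushout.inl R ⁻¹' X) =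
        (fun z : R => z.1.2) ⁻¹' (RelPushout.inr R ⁻¹' X) := by
    ext z
    have : RelPushout.inl R z.1.1 = RelPushout.inr R z.1.2 := Quot.sound ⟨_, z.2, rfl, rfl⟩
    simp only [Set.mem_preimage, this]
  refine ⟨⟨Quot.lift (Sum.elim (fun s => {X | RelPushout.inl R ⁻¹' X ∈ M₁.nu s})
    fun s => {X | RelPushout.inr R ⁻¹' X ∈ M₂.nu s}) ?_,
    fun j => {q | Quot.lift (Sum.elim (fun s => s ∈ M₁.V j) fun s => s ∈ M₂.V j) ?_ q}⟩,
    ⟨fun _ _ => Iff.rfl, fun _ _ => Iff.rfl⟩, ⟨fun _ _ => Iff.rfl, fun _ _ => Iff.rfl⟩⟩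
  · rintro _ _ ⟨z, hz, rfl, rfl⟩
    ext X
    exact (h₁.nu_iff ⟨z, hz⟩ _).symm.trans (by rw [hcomp]; exact h₂.nu_iff ⟨z, hz⟩ _)
  · rintro _ _ ⟨z, hz, rfl, rfl⟩
    exact propext ((h₁.V_iff j ⟨z, hz⟩).symm.trans (h₂.V_iff j ⟨z, hz⟩))

theorem Bisimilar.precocongRelated {s₁ : S₁} {s₂ : S₂} (h : Bisimilar M₁ M₂ s₁ s₂) :
    PrecocongRelated M₁ M₂ s₁ s₂ :=
  h.imp fun _ hR => ⟨hR.1.isPrecocongruence, hR.2⟩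

/-- The graph of a bounded morphism is a bisimulation. -/
theorem IsBoundedMorphism.bisimilar {f : S₁ → S₂} (hf : IsBoundedMorphism M₁ M₂ f) (s : S₁) :
    Bisimilar M₁ M₂ s (f s) := by
  -- The structure of `M₁` is transported along the bijection between `S₁` and the graph.
  refine ⟨{z | z.2 = f z.1}, ⟨⟨fun z => {X | (fun t => ⟨(t, f t), rfl⟩) ⁻¹' X ∈ M₁.nu z.1.1},
    fun j => {z | z.1.1 ∈ M₁.V j}⟩, ⟨fun _ _ => Iff.rfl, fun _ _ => Iff.rfl⟩, ⟨?_, ?_⟩⟩, rfl⟩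
  · rintro ⟨⟨s, t⟩, rfl : t = f s⟩ X
    exact hf.nu_iff s X
  · rintro j ⟨⟨s, t⟩, rfl : t = f s⟩
    exact hf.V_iff j s

end Relations

/-- Invariance under bisimilarity implies invariance under behavioural equivalence. -/
theorem InvariantUnder.behEquivalent_of_bisimilar {α : FOFormula 1 0}
    (h : InvariantUnder.{u} Bisimilar α) : InvariantUnder.{u} BehEquivalent α := by
  rintro A₁ hA₁ A₂ hA₂ s₁ s₂ ⟨Y, N, f₁, f₂, h₁, h₂, hs⟩
  rw [← N.toNbhd_toFO] at h₁ h₂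
  have e₁ := h A₁ hA₁ N.toFO N.toFO_mem_classN _ _ (h₁.bisimilar s₁)
  have e₂ := h A₂ hA₂ N.toFO N.toFO_mem_classN _ _ (h₂.bisimilar s₂)
  rw [e₁, e₂, hs]

/-- Translations of modal formulas are invariant under behavioural equivalence. -/
theorem EquivToModal.invariantUnder_behEquivalent {α : FOFormula 1 0} (h : EquivToModal.{u} α) :
    InvariantUnder.{u} BehEquivalent α := by
  obtain ⟨φ, hφ⟩ := h
  rintro A₁ hA₁ A₂ hA₂ s₁ s₂ ⟨Y, N, f₁, f₂, h₁, h₂, hs⟩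
  rw [hφ A₁ hA₁, hφ A₂ hA₂, A₁.models_st, A₂.models_st, ← h₁.preimage_truth, ← h₂.preimage_truth,
    Set.mem_preimage, Set.mem_preimage, hs]

/-- The disjoint union of a family of neighbourhood models. -/
def NbhdModel.sigma {ι : Type} {S : ι → Type u} (M : ∀ i, NbhdModel (S i)) :
    NbhdModel (Σ i, S i) where
  nu s := {X | Sigma.mk s.1 ⁻¹' X ∈ (M s.1).nu s.2}
  V j := {s | s.2 ∈ (M s.1).V j}

theorem NbhdModel.isBoundedMorphism_sigmaMk {ι : Type} {S : ι → Type u}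
    (M : ∀ i, NbhdModel (S i)) (i : ι) :
    IsBoundedMorphism (M i) (NbhdModel.sigma M) (Sigma.mk i) :=
  ⟨fun _ _ => Iff.rfl, fun _ _ => Iff.rfl⟩

/-! ### Ultrapowers and Łoś's theorem -/

namespace FOStructure

/-- The ultrapower of a two-sorted structure. -/
def ultrapower (A : FOStructure.{u}) (U : Ultrafilter ℕ) : FOStructure.{u} where
  Ds := Germ (U : Filter ℕ) A.Ds
  Dn := Germ (U : Filter ℕ) A.Dn
  P i := Germ.LiftPred (A.P i)
  N := Germ.LiftRel A.N
  E := Germ.LiftRel A.E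

variable (A : FOStructure.{u}) (U : Ultrafilter ℕ)

/-- The element of the ultrapower represented by a sequence of states. -/
def stateClass (s : ℕ → A.Ds) : (A.ultrapower U).Ds := Germ.ofFun s

/-- The element of the ultrapower represented by a sequence of neighbourhoods. -/
def nbhdClass (a : ℕ → A.Dn) : (A.ultrapower U).Dn := Germ.ofFun a

theorem stateClass_surjective : Function.Surjective (A.stateClass U) := Quotient.mk_surjective

theorem nbhdClass_surjective : Function.Surjective (A.nbhdClass U) := Quotient.mk_surjective

variable {A U} in
theorem stateClass_eq {s t : ℕ → A.Ds} :
    A.stateClass U s = A.stateClass U t ↔ ∀ᶠ i in (U : Filter ℕ), s i = t i :=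
  Germ.coe_eq

variable {A U} in
theorem nbhdClass_eq {a b : ℕ → A.Dn} :
    A.nbhdClass U a = A.nbhdClass U b ↔ ∀ᶠ i in (U : Filter ℕ), a i = b i :=
  Germ.coe_eq

variable {A U} in
theorem ultrapower_N {s : ℕ → A.Ds} {a : ℕ → A.Dn} :
    (A.ultrapower U).N (A.stateClass U s) (A.nbhdClass U a) ↔
      ∀ᶠ i in (U : Filter ℕ), A.N (s i) (a i) :=
  Iff.rfl

variable {A U} in
theorem ultrapower_E {a : ℕ → A.Dn} {s : ℕ → A.Ds} :
    (A.ultrapower U).E (A.nbhdClass U a) (A.stateClass U s) ↔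
      ∀ᶠ i in (U : Filter ℕ), A.E (a i) (s i) :=
  Iff.rfl

theorem eventually_exists_iff {T : Type*} (p : ℕ → T → Prop) :
    (∀ᶠ i in (U : Filter ℕ), ∃ d, p i d) ↔ ∃ d : ℕ → T, ∀ᶠ i in (U : Filter ℕ), p i (d i) := by
  constructor
  · intro h
    -- `T` may be empty a priori; an index with a witness supplies the default value.
    obtain ⟨_, d₀, _⟩ := h.exists
    classical
    refine ⟨fun i => if h : ∃ d, p i d then h.choose else d₀, h.mono fun i hi => ?_⟩
    simp only [dif_pos hi]
    exact hi.choose_spec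
  · rintro ⟨d, hd⟩
    exact hd.mono fun i hi => ⟨d i, hi⟩

/-- Łoś's theorem for two-sorted ultrapowers. -/
theorem sat_ultrapower {n m : ℕ} (φ : FOFormula n m) (a : Fin n → ℕ → A.Ds)
    (b : Fin m → ℕ → A.Dn) :
    (A.ultrapower U).Sat φ (fun k => A.stateClass U (a k)) (fun k => A.nbhdClass U (b k)) ↔
      ∀ᶠ i in (U : Filter ℕ), A.Sat φ (fun k => a k i) (fun k => b k i) := by
  induction φ with
  | eqS x y => exact stateClass_eq
  | eqN x y => exact nbhdClass_eq
  | relP i x => exact Iff.rfl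
  | relN x y => exact Iff.rfl
  | relE x y => exact Iff.rfl
  | neg φ ih => simp only [Sat, ih, Ultrafilter.eventually_not]
  | and φ ψ ih ih' => simp only [Sat, ih, ih', eventually_and]
  | @exS n m φ ih =>
    simp only [Sat, eventually_exists_iff]
    rw [(A.stateClass_surjective U).exists]
    refine exists_congr fun d => ?_
    convert ih (Fin.cons d a) b using 2
    · funext k
      cases k using Fin.cases <;> rfl
    · ext i
      refine iff_of_eq (congrArg (fun c => A.Sat φ c _) ?_)
      funext k
      cases k using Fin.cases <;> rfl
  | @exN n m φ ih =>
    simp only [Sat, eventually_exists_iff]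
    rw [(A.nbhdClass_surjective U).exists]
    refine exists_congr fun d => ?_
    convert ih a (Fin.cons d b) using 2
    · funext k
      cases k using Fin.cases <;> rfl
    · ext i
      refine iff_of_eq (congrArg (fun c => A.Sat φ _ c) ?_)
      funext k
      cases k using Fin.cases <;> rfl

theorem models_ultrapower (α : FOFormula 1 0) (s : ℕ → A.Ds) :
    (A.ultrapower U).Models α (A.stateClass U s) ↔
      ∀ᶠ i in (U : Filter ℕ), A.Models α (s i) := by
  have h := A.sat_ultrapower U α (fun _ => s) Fin.elim0
  have e₁ : (fun k => A.nbhdClass U (Fin.elim0 k)) = Fin.elim0 := Subsingleton.elim _ _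
  have e₂ (i : ℕ) : (fun k => (Fin.elim0 k : ℕ → A.Dn) i) = Fin.elim0 := Subsingleton.elim _ _
  simp only [e₁, e₂] at h
  exact h

theorem mem_truth_ultrapower (φ : ModalFormula) (s : ℕ → A.Ds) :
    A.stateClass U s ∈ φ.truth (A.ultrapower U).toNbhd ↔
      ∀ᶠ i in (U : Filter ℕ), s i ∈ φ.truth A.toNbhd := by
  simp only [← models_st, models_ultrapower]

/-- The ultrapower of the translation of a neighbourhood model is again such a translation. -/
theorem ultrapower_mem_classN {S : Type u} (M : NbhdModel S) :
    M.toFO.ultrapower U ∈ classN := by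
  refine mem_classN_of_extensional ?_ ?_
  · intro a b
    obtain ⟨a, rfl⟩ := M.toFO.nbhdClass_surjective U a
    obtain ⟨b, rfl⟩ := M.toFO.nbhdClass_surjective U b
    intro h
    rw [nbhdClass_eq]
    by_contra hne
    rw [← Ultrafilter.eventually_not] at hne
    -- Distinct neighbourhoods of `M` are distinct sets, so some state separates them at almost
    -- every index; chosen separators represent a separating state of the ultrapower.
    have hex : ∀ᶠ i in (U : Filter ℕ), ∃ t, ¬ (M.toFO.E (a i) t ↔ M.toFO.E (b i) t) := by
      refine hne.mono fun i hi => ?_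
      by_contra hcon
      push Not at hcon
      exact hi (Subtype.ext (Set.ext hcon))
    obtain ⟨t, ht⟩ := (eventually_exists_iff U _).1 hex
    have := h (M.toFO.stateClass U t)
    rw [ultrapower_E, ultrapower_E] at this
    rw [Ultrafilter.eventually_not] at ht
    apply ht
    by_cases hE : ∀ᶠ i in (U : Filter ℕ), M.toFO.E (a i) (t i)
    · filter_upwards [hE, this.1 hE] with i h₁ h₂ using ⟨fun _ => h₂, fun _ => h₁⟩
    · have hE' := mt this.2 hE
      rw [← Ultrafilter.eventually_not] at hE hE'
      filter_upwards [hE, hE'] with i h₁ h₂ using ⟨fun h => (h₁ h).elim, fun h => (h₂ h).elim⟩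
  · intro a
    obtain ⟨a, rfl⟩ := M.toFO.nbhdClass_surjective U a
    exact ⟨M.toFO.stateClass U fun i => (a i).2.choose,
      Eventually.of_forall fun i => (a i).2.choose_spec⟩

end FOStructure

/-! ### Saturation and the quotient by modal equivalence -/

/-- Countable saturation: a decreasing sequence of conditions each of which is satisfiable almost
everywhere admits a common solution almost everywhere. -/
theorem exists_forall_eventually {T : Type*} {U : Filter ℕ} [U.NeBot] (hU : U ≤ atTop)
    (p : ℕ → ℕ → T → Prop) (hp : ∀ i d, Antitone fun k => p k i d)
    (h : ∀ k, ∀ᶠ i in U, ∃ d, p k i d) : ∃ d : ℕ → T, ∀ k, ∀ᶠ i in U, p k i (d i) := by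
  classical
  obtain ⟨_, d₀, _⟩ := (h 0).exists
  -- The diagonal choice solves, at index `i`, the strongest condition among those numbered at most
  -- `i` that is satisfiable there. Since `U ≤ atTop`, almost every `i` has `k ≤ K i`, and
  -- antitonicity yields condition `k`.
  let K (i : ℕ) : ℕ := Nat.findGreatest (fun k => ∃ d, p k i d) i
  refine ⟨fun i => if h : ∃ d, p (K i) i d then h.choose else d₀, fun k => ?_⟩
  filter_upwards [h k, hU (eventually_ge_atTop k)] with i hi hki
  have hK : ∃ d, p (K i) i d := Nat.findGreatest_spec (P := fun k => ∃ d, p k i d) hki hi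
  have hkK : k ≤ K i := Nat.le_findGreatest hki hi
  rw [dif_pos hK]
  exact hp i _ hkK hK.choose_spec

/-- In an ultrapower, a neighbourhood that is closed under modal equivalence is defined by a modal
formula. -/
theorem FOStructure.exists_truth_eq_of_closed (A : FOStructure.{u}) {U : Ultrafilter ℕ}
    (hU : (U : Filter ℕ) ≤ atTop) (a : (A.ultrapower U).Dn)
    (ha : ∀ s t, (∀ φ : ModalFormula, s ∈ φ.truth (A.ultrapower U).toNbhd ↔
      t ∈ φ.truth (A.ultrapower U).toNbhd) → (A.ultrapower U).E a s → (A.ultrapower U).E a t) :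
    ∃ φ : ModalFormula, {t | (A.ultrapower U).E a t} = φ.truth (A.ultrapower U).toNbhd := by
  obtain ⟨e, he⟩ := exists_surjective_nat ModalFormula
  obtain ⟨a, rfl⟩ := A.nbhdClass_surjective U a
  by_contra hcon
  -- Otherwise `a` would be closed under agreement on the first `k` formulas, hence definable.
  have hpairs (k : ℕ) : ∀ᶠ i in (U : Filter ℕ), ∃ d : A.Ds × A.Ds,
      (∀ j < k, d.1 ∈ (e j).truth A.toNbhd ↔ d.2 ∈ (e j).truth A.toNbhd) ∧
        A.E (a i) d.1 ∧ ¬ A.E (a i) d.2 := by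
    by_contra hk
    refine hcon ((exists_definition (fun s φ => s ∈ φ.truth (A.ultrapower U).toNbhd)
      (fun _ h => h) (fun _ _ => Iff.rfl) (fun _ _ _ => Iff.rfl) e k
      {t | (A.ultrapower U).E (A.nbhdClass U a) t} ?_).imp fun φ hφ => Set.ext hφ)
    intro s t
    obtain ⟨s, rfl⟩ := A.stateClass_surjective U s
    obtain ⟨t, rfl⟩ := A.stateClass_surjective U t
    intro hst hs
    by_contra ht
    rw [Set.mem_ofPred_eq, ultrapower_E] at hs ht
    rw [← Ultrafilter.eventually_not] at ht
    have hall : ∀ᶠ i in (U : Filter ℕ), ∀ j ∈ Finset.range k,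
        s i ∈ (e j).truth A.toNbhd ↔ t i ∈ (e j).truth A.toNbhd := by
      rw [Filter.eventually_all_finset]
      intro j hj
      have := hst j (Finset.mem_range.1 hj)
      rw [mem_truth_ultrapower, mem_truth_ultrapower] at this
      by_cases h : ∀ᶠ i in (U : Filter ℕ), s i ∈ (e j).truth A.toNbhd
      · filter_upwards [h, this.1 h] with i h₁ h₂ using ⟨fun _ => h₂, fun _ => h₁⟩
      · have h' := mt this.2 h
        rw [← Ultrafilter.eventually_not] at h h'
        filter_upwards [h, h'] with i h₁ h₂ using ⟨fun h => (h₁ h).elim, fun h => (h₂ h).elim⟩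
    refine hk ?_
    filter_upwards [hs, ht, hall] with i h₁ h₂ h₃
    exact ⟨(s i, t i), fun j hj => h₃ j (Finset.mem_range.2 hj), h₁, h₂⟩
  obtain ⟨d, hd⟩ := exists_forall_eventually hU _
    (fun i d k l hkl h => ⟨fun j hj => h.1 j (hj.trans_le hkl), h.2⟩) hpairs
  -- The two coordinates of `d` represent modally equivalent states, the first in `a` and the second
  -- outside it, against closure.
  have hE : (A.ultrapower U).E (A.nbhdClass U a) (A.stateClass U fun i => (d i).2) := by
    refine ha (A.stateClass U fun i => (d i).1) _ (fun φ => ?_) ((hd 0).mono fun i hi => hi.2.1)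
    obtain ⟨j, rfl⟩ := he φ
    rw [mem_truth_ultrapower, mem_truth_ultrapower]
    exact eventually_congr ((hd (j + 1)).mono fun i hi => hi.1 j j.lt_succ_self)
  obtain ⟨i, hi₁, hi₂⟩ := (hE.and (hd 0)).exists
  exact hi₂.2.2 hi₁

/-- If every neighbourhood that is closed under modal equivalence is defined by a modal formula,
then modally equivalent states are behaviourally equivalent. -/
theorem NbhdModel.behEquivalent_of_modallyEquivalent {S : Type u} (M : NbhdModel S)
    (hM : ∀ s, ∀ X ∈ M.nu s,
      (∀ t t', (∀ φ : ModalFormula, t ∈ φ.truth M ↔ t' ∈ φ.truth M) → t ∈ X → t' ∈ X) →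
        ∃ φ : ModalFormula, X = φ.truth M)
    {s t : S} (hst : ∀ φ : ModalFormula, s ∈ φ.truth M ↔ t ∈ φ.truth M) :
    BehEquivalent M M s t := by
  let r : Setoid S := ⟨fun t t' => ∀ φ : ModalFormula, t ∈ φ.truth M ↔ t' ∈ φ.truth M,
    fun _ _ => Iff.rfl, fun h φ => (h φ).symm, fun h h' φ => (h φ).trans (h' φ)⟩
  have hnu : ∀ (t t' : S), r t t' → ∀ X : Set (Quotient r),
      Quotient.mk r ⁻¹' X ∈ M.nu t → Quotient.mk r ⁻¹' X ∈ M.nu t' := by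
    intro t t' htt' X hX
    -- A preimage under the quotient map is closed under modal equivalence, so it is the truth set
    -- of some φ, and □φ carries it from `t` to `t'`.
    obtain ⟨φ, hφ⟩ := hM t _ hX fun x y hxy hx => by
      rwa [Set.mem_preimage, ← (Quotient.sound hxy : Quotient.mk r x = Quotient.mk r y)]
    rw [hφ] at hX ⊢
    exact (htt' (.box φ)).1 hX
  let N : NbhdModel (Quotient r) :=
    ⟨Quotient.lift (fun t => {X | Quotient.mk r ⁻¹' X ∈ M.nu t}) fun t t' h =>
      Set.ext fun X => ⟨hnu t t' h X, hnu t' t (r.symm h) X⟩,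
      fun j => {q | Quotient.lift (fun t => t ∈ M.V j)
        (fun _ _ (h : r _ _) => propext (h (.atom j))) q}⟩
  have hmk : IsBoundedMorphism M N (Quotient.mk r) :=
    ⟨fun _ _ => Iff.rfl, fun _ _ => Iff.rfl⟩
  exact ⟨_, N, _, _, hmk, hmk, Quotient.sound hst⟩

/-! ### From invariance to modal definability -/

/-- Formulas that are invariant under behavioural equivalence are equivalent to translations of
modal formulas. -/
theorem InvariantUnder.equivToModal {α : FOFormula 1 0}
    (h : InvariantUnder.{u} BehEquivalent α) : EquivToModal.{u} α := by
  obtain ⟨e, he⟩ := exists_surjective_nat ModalFormula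
  by_contra hcon
  let W := Σ A : classN.{u}, A.1.Ds
  have hpairs (k : ℕ) : ∃ w w' : W, (∀ j < k, w.2 ∈ (e j).truth w.1.1.toNbhd ↔
      w'.2 ∈ (e j).truth w'.1.1.toNbhd) ∧ w.1.1.Models α w.2 ∧ ¬ w'.1.1.Models α w'.2 := by
    by_contra hk
    obtain ⟨φ, hφ⟩ := exists_definition (fun (w : W) φ => w.2 ∈ φ.truth w.1.1.toNbhd)
      (fun _ h => h) (fun _ _ => Iff.rfl) (fun _ _ _ => Iff.rfl) e k
      {w | w.1.1.Models α w.2} fun w w' hw hα => by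
        by_contra hα'
        exact hk ⟨w, w', hw, hα, hα'⟩
    exact hcon ⟨φ, fun A hA s => (hφ ⟨⟨A, hA⟩, s⟩).trans (A.models_st φ s).symm⟩
  choose w w' hagree hα hα' using hpairs
  -- All the counterexample pairs go into a single disjoint union, so that an ultrapower of one
  -- model suffices; `true` marks the states satisfying α.
  let x : ℕ × Bool → W := fun p => cond p.2 (w p.1) (w' p.1)
  let M := NbhdModel.sigma fun p => (x p).1.1.toNbhd
  let y (p : ℕ × Bool) : M.toFO.Ds := ⟨p, (x p).2⟩
  -- Each summand inclusion is a bounded morphism, so invariance itself carries the truth value of α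
  -- into the union.
  have hy (p : ℕ × Bool) : M.toFO.Models α (y p) ↔ (x p).1.1.Models α (x p).2 := by
    have hB : BehEquivalent (x p).1.1.toNbhd M.toFO.toNbhd (x p).2 (y p) := by
      rw [M.toNbhd_toFO]
      let f : (x p).1.1.Ds → M.toFO.Ds := fun s => ⟨p, s⟩
      exact ⟨_, M, f, fun z => z,
        NbhdModel.isBoundedMorphism_sigmaMk (fun p => (x p).1.1.toNbhd) p,
        IsBoundedMorphism.id M, rfl⟩
    exact (h _ (x p).1.2 _ M.toFO_mem_classN _ _ hB).symm
  have hy' (p : ℕ × Bool) (φ : ModalFormula) :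
      y p ∈ φ.truth M.toFO.toNbhd ↔ (x p).2 ∈ φ.truth (x p).1.1.toNbhd := by
    rw [M.toNbhd_toFO, ← (NbhdModel.isBoundedMorphism_sigmaMk
      (fun p => (x p).1.1.toNbhd) p).preimage_truth φ]
    rfl
  let U : Ultrafilter ℕ := hyperfilter ℕ
  have hU : (U : Filter ℕ) ≤ atTop := Nat.hyperfilter_le_atTop
  have hBeh : BehEquivalent (M.toFO.ultrapower U).toNbhd (M.toFO.ultrapower U).toNbhd
      (M.toFO.stateClass U fun n => y (n, true)) (M.toFO.stateClass U fun n => y (n, false)) := by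
    refine NbhdModel.behEquivalent_of_modallyEquivalent _ ?_ fun φ => ?_
    · rintro s _ ⟨a, _, rfl⟩ hcl
      exact M.toFO.exists_truth_eq_of_closed hU a hcl
    · obtain ⟨j, rfl⟩ := he φ
      rw [FOStructure.mem_truth_ultrapower, FOStructure.mem_truth_ultrapower]
      have hj : ∀ᶠ n in (U : Filter ℕ), j < n := hU (eventually_gt_atTop j)
      refine eventually_congr (hj.mono fun n hn => ?_)
      rw [hy', hy']
      exact hagree n j hn
  have hiff := h _ (FOStructure.ultrapower_mem_classN U M) _
    (FOStructure.ultrapower_mem_classN U M) _ _ hBeh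
  rw [FOStructure.models_ultrapower, FOStructure.models_ultrapower] at hiff
  obtain ⟨n, hn⟩ := (hiff.1 (Eventually.of_forall fun n => (hy (n, true)).2 (hα n))).exists
  exact hα' n ((hy (n, false)).1 hn)

theorem theorem4p4 (α : FOFormula 1 0) :
    List.TFAE
      [EquivToModal.{u} α,
       InvariantUnder.{u} BehEquivalent α,
       InvariantUnder.{u} PrecocongRelated α,
       InvariantUnder.{u} Bisimilar α] := by
  tfae_have 1 → 2 := EquivToModal.invariantUnder_behEquivalent
  tfae_have 2 → 1 := InvariantUnder.equivToModal
  tfae_have 2 → 3 := fun h A₁ hA₁ A₂ hA₂ s₁ s₂ hs => h A₁ hA₁ A₂ hA₂ s₁ s₂ hs.behEquivalent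
  tfae_have 3 → 4 := fun h A₁ hA₁ A₂ hA₂ s₁ s₂ hs => h A₁ hA₁ A₂ hA₂ s₁ s₂ hs.precocongRelated
  tfae_have 4 → 2 := InvariantUnder.behEquivalent_of_bisimilar
  tfae_finish
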